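/- **Setting.** Let $f:\mathbb{R}^d\to\mathbb{R}$ be differentiable and bounded below, $f^\star=\inf f$, with $L$-Lipschitz gradient ($L\ge 0$) for the Euclidean norm. Fix $\eta>0$, $v_0>0$ and a point $x_1\in\mathbb{R}^d$. AdaGrad-Norm with learning rate $\eta$ computes, for $k\ge 1$, $$v_k=v_{k-1}+\|g_k\|^2,\qquad x_{k+1}=x_k-\frac{\eta}{\sqrt{v_k}}\,g_k ,$$ where the $g_k$ are square-integrable stochastic gradients on a probability space. With $\mathcal{F}_k=\sigma(g_1,\dots,g_{k-1})$ they satisfy, for all $k\ge1$, almost surely, $\mathbb{E}[g_k\mid\mathcal{F}_k]=\nabla f(x_k)$ and, for constants $D_0,D_1>0$, $$\mathbb{E}[\|g_k\|^2\mid\mathcal{F}_k]\le D_0+D_1\|\nabla f(x_k)\|^2 .$$ Put $\xi(0)=\|\nabla f(x_1)\|^2/\sqrt{v_0}$ and, for $\ell\in\mathbb{R}$, $$B(\ell)=\frac4\eta\bigl(f(x_1)-f^\star\bigr)+2D_1\xi(0)+\Bigl(2(L\eta D_1)^2+D_1(L\eta)^2+\frac{D_0}{2}\Bigr)\frac{4}{\sqrt{v_0}}+2L\eta\,\ell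 .$$ **Claim.** For all $D_0,D_1,v_0>0$ and $\Gamma\in\mathbb{R}$ there is a constant $C>0$, depending only on $D_0$, $D_1$, $v_0$, $\Gamma$ (so not on $K$, $\eta$, $L$, $d$, $f$ or the law of the noise), such that in the setting above, whenever $\|\nabla f(x_1)\|\le\Gamma$, for every $K\ge1$ the random variables $\min_{1\le k\le K}\|\nabla f(x_k)\|^2$, its square root, $\sqrt{v_K}$ and $\ln v_K$ are integrable and $$\Bigl(\mathbb{E}\Bigl[\sqrt{\min_{1\le k\le K}\|\nabla f(x_k)\|^2}\,\Bigr]\Bigr)^2\le\frac{C}{\mathbb{E}[\sqrt{v_K}]}\;B\bigl(\mathbb{E}[\ln v_K]-\ln v_0\bigr).$$ If moreover $v_0\ge1$, then also $$\Bigl(\mathbb{E}\Bigl[\sqrt{\min_{1\le k\le K}\|\nabla f(x_k)\|^2}\,\Bigr]\Bigr)^2\le\frac{C}{\mathbb{E}[\sqrt{v_K}]}\;B\bigl(\mathbb{E}[\ln v_K]\bigr).$$ -/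

import Mathlib

open MeasureTheory ProbabilityTheory

/-- `f` is differentiable and its gradient is `L`-Lipschitz for the Euclidean norm. -/
structure IsLSmooth {d : ℕ} (f : EuclideanSpace ℝ (Fin d) → ℝ) (L : ℝ) : Prop where
  differentiable : Differentiable ℝ f
  gradient_lipschitz : ∀ x y, ‖gradient f x - gradient f y‖ ≤ L * ‖x - y‖

/-- The accumulator of AdaGrad-Norm: `v 0 = v₀ > 0` is the initial value and
`v k = v (k - 1) + ‖g k‖ ^ 2` for `k ≥ 1`. The value `g 0` is never used. -/
noncomputable def adaGradAccum {d : ℕ} {Ω : Type*} (v₀ : ℝ)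
    (g : ℕ → Ω → EuclideanSpace ℝ (Fin d)) : ℕ → Ω → ℝ
  | 0, _ => v₀
  | k + 1, ω => adaGradAccum v₀ g k ω + ‖g (k + 1) ω‖ ^ 2

/-- The iterates of AdaGrad-Norm with constant learning rate `η`, started at the deterministic
point `x₁`: `x 1 = x₁` and `x (k + 1) = x k - (η / √(v k)) • g k` for `k ≥ 1`.
By convention `x 0 = x₁`. -/
noncomputable def adaGradIter {d : ℕ} {Ω : Type*} (η v₀ : ℝ) (x₁ : EuclideanSpace ℝ (Fin d))
    (g : ℕ → Ω → EuclideanSpace ℝ (Fin d)) : ℕ → Ω → EuclideanSpace ℝ (Fin d)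
  | 0, _ => x₁
  | 1, _ => x₁
  | k + 2, ω => adaGradIter η v₀ x₁ g (k + 1) ω
      - (η / √(adaGradAccum v₀ g (k + 1) ω)) • g (k + 1) ω

/-- The sigma-algebra `𝓕 k = σ(g (k - 1), …, g 1)` of the past gradients. -/
@[reducible] def gradHistory {d : ℕ} {Ω : Type*} (g : ℕ → Ω → EuclideanSpace ℝ (Fin d)) (k : ℕ) :
    MeasurableSpace Ω :=
  ⨆ j ∈ Finset.Ico 1 k, MeasurableSpace.comap (g j) inferInstance

/-- The vectors `g 1, g 2, …` are stochastic gradients of `f` along the AdaGrad-Norm run that they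
generate (square integrable and conditionally unbiased), and their noise variance is affine:
`𝔼[‖g k‖ ^ 2 | 𝓕 k] ≤ D₀ + D₁ * ‖∇ f (x k)‖ ^ 2`. -/
structure IsAffineStochasticGradient {d : ℕ} {Ω : Type*} [MeasurableSpace Ω] (μ : Measure Ω)
    (f : EuclideanSpace ℝ (Fin d) → ℝ) (D₀ D₁ η v₀ : ℝ) (x₁ : EuclideanSpace ℝ (Fin d))
    (g : ℕ → Ω → EuclideanSpace ℝ (Fin d)) : Prop where
  measurable : ∀ k, 1 ≤ k → Measurable (g k)
  memLp : ∀ k, 1 ≤ k → MemLp (g k) 2 μ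
  unbiased : ∀ k, 1 ≤ k →
    μ[g k | gradHistory g k] =ᵐ[μ] fun ω => gradient f (adaGradIter η v₀ x₁ g k ω)
  affine : ∀ k, 1 ≤ k →
    μ[fun ω => ‖g k ω‖ ^ 2 | gradHistory g k] ≤ᵐ[μ]
      fun ω => D₀ + D₁ * ‖gradient f (adaGradIter η v₀ x₁ g k ω)‖ ^ 2

/-- `ξ k = ‖∇ f (x k)‖ ^ 2 / √(v k)`; since `x 0 = x₁`, `ξ 0` is the number
`‖∇ f x₁‖ ^ 2 / √v₀`, and `adaGradXiZero` is that number. -/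
noncomputable def adaGradXiZero {d : ℕ} (f : EuclideanSpace ℝ (Fin d) → ℝ) (v₀ : ℝ)
    (x₁ : EuclideanSpace ℝ (Fin d)) : ℝ :=
  ‖gradient f x₁‖ ^ 2 / √v₀

/-- The bracket of the bound, with `ℓ` in the place of the logarithm and with `f⋆ = inf f`. -/
noncomputable def adaGradBracket {d : ℕ} (f : EuclideanSpace ℝ (Fin d) → ℝ)
    (L D₀ D₁ η v₀ : ℝ) (x₁ : EuclideanSpace ℝ (Fin d)) (ℓ : ℝ) : ℝ :=
  4 / η * (f x₁ - ⨅ x, f x) + 2 * D₁ * adaGradXiZero f v₀ x₁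
    + (2 * (L * η * D₁) ^ 2 + D₁ * (L * η) ^ 2 + D₀ / 2) * (4 / √v₀)
    + 2 * L * η * ℓ

/-- `min_{1 ≤ k ≤ K} ‖∇ f (x k)‖ ^ 2` along the run. -/
noncomputable def adaGradMinGradSq {d : ℕ} {Ω : Type*} (f : EuclideanSpace ℝ (Fin d) → ℝ)
    (η v₀ : ℝ) (x₁ : EuclideanSpace ℝ (Fin d)) (g : ℕ → Ω → EuclideanSpace ℝ (Fin d))
    (K : ℕ) (hK : 1 ≤ K) (ω : Ω) : ℝ :=
  (Finset.Icc 1 K).inf' (Finset.nonempty_Icc.mpr hK)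
    fun k => ‖gradient f (adaGradIter η v₀ x₁ g k ω)‖ ^ 2

/-! For one step write `s`, `t` for the roots of the accumulator before and after it, `p` for the
norm of the stochastic gradient, and `G`, `G'` for the norms of the true gradient before and after.
Let `Q` be the expected sum of the terms `G ^ 2 / s`, and `S` the expectation of `√(v K)`.

Bounding `Q`. The descent inequality contains `u / t`, where `u` is the inner product of the two
gradients and `t` depends on the current noise. Replacing `t` by `s`, which the past determines,
gives mean `G ^ 2 / s`. The error is split by a weighted AM-GM with `M = D₀ + D₁ * G ^ 2`, the bound
on the conditional second moment (`surrogate_error`). One half has mean at most `G ^ 2 / (2 * s)`;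
the other is `M * (1 / s - 1 / t) / 2`. Its `D₀` part telescopes, but its `D₁ * G ^ 2` part does
not. Adding `D₁ / 2 * G ^ 2 / s` to the potential `f / η` cancels that part, at the cost of `G ^ 2 /
(4 * s)` and more telescoping terms (`gradient_sq_increment`). A quarter of `G ^ 2 / s` survives,
hence the factors 4 in the bracket; the second order terms sum to a logarithm.

From `Q` to the smallest gradient. Let `m` be the expectation of its norm. Cauchy-Schwarz gives `K *
m ^ 2 ≤ S * Q`. Separating bounded noise from noise proportional to the gradient gives `S ≤ √(v₀ + K
* D₀) + D₁ * Q`. If the root dominates, then `S ^ 2` is of order `K`, and the first inequality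
suffices; otherwise `S ≤ 2 * D₁ * Q`, and the trivial bound `m ≤ Γ` suffices. This is where the
constant acquires its dependence on `Γ`. -/

/-! ### Consequences of smoothness. -/

theorem IsLSmooth.descent {d : ℕ} {f : EuclideanSpace ℝ (Fin d) → ℝ} {L : ℝ}
    (hf : IsLSmooth f L) (x h : EuclideanSpace ℝ (Fin d)) :
    f (x - h) ≤ f x - inner ℝ (gradient f x) h + L / 2 * ‖h‖ ^ 2 := by
  -- Along the segment, `f` minus its claimed quadratic majorant has nonpositive derivative on `[0,
  -- 1]`; compare the endpoints.
  have hder : ∀ t : ℝ, HasDerivAt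
      (fun t : ℝ => f (x - t • h) + t * inner ℝ (gradient f x) h - L / 2 * ‖h‖ ^ 2 * t ^ 2)
      (-inner ℝ (gradient f (x - t • h)) h + inner ℝ (gradient f x) h
        - L / 2 * ‖h‖ ^ 2 * (2 * t)) t := by
    intro t
    have h1 : HasDerivAt (fun t : ℝ => x - t • h) (-h) t := by
      simpa using ((hasDerivAt_id t).smul_const h).const_sub x
    have h2 := (hf.differentiable (x - t • h)).hasGradientAt.hasFDerivAt.comp_hasDerivAt t h1
    have h3 := (hasDerivAt_id t).mul_const (inner ℝ (gradient f x) h)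
    have h4 := (hasDerivAt_pow 2 t).const_mul (L / 2 * ‖h‖ ^ 2)
    have h5 := (h2.add h3).sub h4
    refine h5.congr_deriv ?_
    simp
  have hanti := antitoneOn_of_hasDerivWithinAt_nonpos (convex_Icc (0 : ℝ) 1)
    (fun t _ => (hder t).continuousAt.continuousWithinAt)
    (fun t _ => (hder t).hasDerivWithinAt) (by
      intro t ht
      rw [interior_Icc] at ht
      have h6 : inner ℝ (gradient f x - gradient f (x - t • h)) h ≤ L * (t * ‖h‖) * ‖h‖ := by
        refine (real_inner_le_norm _ _).trans ?_
        gcongr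
        have := hf.gradient_lipschitz x (x - t • h)
        rwa [sub_sub_cancel, norm_smul, Real.norm_of_nonneg ht.1.le] at this
      rw [inner_sub_left] at h6
      nlinarith)
  have := hanti (Set.left_mem_Icc.2 zero_le_one) (Set.right_mem_Icc.2 zero_le_one) zero_le_one
  simp only [one_smul, zero_smul, sub_zero, one_mul, zero_mul, one_pow, mul_one, add_zero, ne_eq,
    OfNat.ofNat_ne_zero, not_false_eq_true, zero_pow, mul_zero] at this
  linarith

theorem IsLSmooth.continuous_gradient {d : ℕ} {f : EuclideanSpace ℝ (Fin d) → ℝ} {L : ℝ}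
    (hL : 0 ≤ L) (hf : IsLSmooth f L) : Continuous (gradient f) :=
  (LipschitzWith.of_dist_le_mul (K := ⟨L, hL⟩) fun x y => by
    rw [dist_eq_norm, dist_eq_norm]
    exact hf.gradient_lipschitz x y).continuous

/-! ### Scalar inequalities for a single step. -/

theorem log_increment_lower_bound {a b : ℝ} (ha : 0 < a) (hb : 0 < b) :
    (b - a) / b ≤ Real.log b - Real.log a := by
  have := Real.log_le_sub_one_of_pos (div_pos ha hb)
  rw [Real.log_div ha.ne' hb.ne'] at this
  rw [sub_div, div_self hb.ne']
  linarith

/-- Makes the sum of `p ^ 2 / t ^ 3` telescope. After cancelling `t - s`, it is `s * (t + s) ≤ 2 * t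
^ 2`. -/
theorem inv_cube_increment {s t : ℝ} (hs : 0 < s) (hst : s ≤ t) :
    (t ^ 2 - s ^ 2) / t ^ 3 ≤ 2 * (1 / s - 1 / t) := by
  have ht := hs.trans_le hst
  have : 2 * (1 / s - 1 / t) - (t ^ 2 - s ^ 2) / t ^ 3
      = (t - s) * (2 * t ^ 2 - s * (t + s)) / (s * t ^ 3) := by
    field_simp
    ring
  have h : 0 ≤ (t - s) * (2 * t ^ 2 - s * (t + s)) / (s * t ^ 3) := by
    have : 0 ≤ 2 * t ^ 2 - s * (t + s) := by nlinarith
    have := sub_nonneg.2 hst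
    positivity
  linarith

/-- The error of replacing `√(v k)` by `√(v (k - 1))` in the inner product term, with the
weight `M = D₀ + D₁ * G ^ 2`. -/
theorem surrogate_error {s t p G M u : ℝ} (hs : 0 < s) (ht : 0 < t)
    (hst : t ^ 2 = s ^ 2 + p ^ 2) (hM : 0 < M) (hu : u ≤ G * p) :
    u * (1 / s - 1 / t) ≤ (p ^ 2 * G ^ 2 / (M * s)) / 2 + M * (1 / s - 1 / t) / 2 := by
  have hst' : s ≤ t := abs_le_of_sq_le_sq' (by nlinarith) ht.le |>.2
  have hd : 1 / s - 1 / t = p ^ 2 / (s * t * (s + t)) := by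
    field_simp
    nlinarith
  have hd0 : 0 ≤ 1 / s - 1 / t := by rw [hd]; positivity
  have h1 : G * p * (1 / s - 1 / t) * 2
      ≤ (p ^ 2 * G ^ 2 / (M * s)) + M * (1 / s - 1 / t) := by
    -- Completing the square; with `e = 1 / s - 1 / t` the remainder is nonnegative because `s * e ≤
    -- 1`.
    have hkey : p ^ 2 * G ^ 2 / (M * s) + M * (1 / s - 1 / t) - G * p * (1 / s - 1 / t) * 2
        = (1 / (M * s)) * ((p * G - M * s * (1 / s - 1 / t)) ^ 2
          + M ^ 2 * s * (1 / s - 1 / t) * (1 - s * (1 / s - 1 / t))) := by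
      generalize 1 / s - 1 / t = e
      field_simp
      ring
    have h2 : 0 ≤ 1 - s * (1 / s - 1 / t) := by
      have : 1 - s * (1 / s - 1 / t) = s / t := by field_simp; ring
      rw [this]; positivity
    have : 0 ≤ p ^ 2 * G ^ 2 / (M * s) + M * (1 / s - 1 / t) - G * p * (1 / s - 1 / t) * 2 := by
      rw [hkey]; positivity
    linarith
  have := mul_le_mul_of_nonneg_right hu hd0
  linarith

/-- Growth of `1 / s` into `1 / t` supplies the negative term that later absorbs the `D₁ * G ^ 2`
half of the surrogate error. The change of gradient costs only a quarter of `G ^ 2 / s` and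
telescoping terms. -/
theorem gradient_sq_increment {s t p G G' a D : ℝ} (hs : 0 < s) (hst : s ≤ t)
    (hG' : 0 ≤ G') (hD : 0 ≤ D) (ht2 : t ^ 2 = s ^ 2 + p ^ 2)
    (h : G' ≤ G + a * (p / t)) :
    D / 2 * (G' ^ 2 / t - G ^ 2 / s)
      ≤ - (D / 2 * G ^ 2 * (1 / s - 1 / t)) + G ^ 2 / s / 4
        + (D ^ 2 * a ^ 2 + D * a ^ 2 / 2) * (2 * (1 / s - 1 / t)) := by
  have ht := hs.trans_le hst
  have h1 : G' ^ 2 ≤ (G + a * (p / t)) ^ 2 := by gcongr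
  have h2 : G' ^ 2 / t ≤ (G + a * (p / t)) ^ 2 / t := by gcongr
  have h3 : G ^ 2 / t ≤ G ^ 2 / s := by gcongr
  have h4 := inv_cube_increment hs hst
  rw [ht2, add_sub_cancel_left] at h4
  have h5 : (D ^ 2 * a ^ 2 + D * a ^ 2 / 2) * (p ^ 2 / t ^ 3)
      ≤ (D ^ 2 * a ^ 2 + D * a ^ 2 / 2) * (2 * (1 / s - 1 / t)) := by gcongr
  have h6 : D / 2 * ((G + a * (p / t)) ^ 2 / t)
      = D / 2 * (G ^ 2 / t) + (D * G * a * p / t ^ 2) + D * a ^ 2 / 2 * (p ^ 2 / t ^ 3) := by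
    field_simp
    ring
  -- AM-GM on the cross term, weighted so that the gradient receives the coefficient 1/4.
  have h7 : D * G * a * p / t ^ 2 ≤ G ^ 2 / t / 4 + D ^ 2 * a ^ 2 * (p ^ 2 / t ^ 3) := by
    have : G ^ 2 / t / 4 + D ^ 2 * a ^ 2 * (p ^ 2 / t ^ 3) - D * G * a * p / t ^ 2
        = (G / 2 - D * a * p / t) ^ 2 / t := by
      field_simp
      ring
    have : 0 ≤ (G / 2 - D * a * p / t) ^ 2 / t := by positivity
    linarith
  have h8 : D / 2 * G ^ 2 * (1 / s - 1 / t) = D / 2 * (G ^ 2 / s) - D / 2 * (G ^ 2 / t) := by ring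
  have h9 := mul_le_mul_of_nonneg_left h2 (by positivity : 0 ≤ D / 2)
  linarith

theorem adaGrad_potential_step {s t p G G' L η D₀ D₁ u F F' : ℝ} (hs : 0 < s)
    (ht : 0 < t) (hG' : 0 ≤ G') (hL : 0 ≤ L) (hη : 0 < η) (hD₀ : 0 < D₀)
    (hD₁ : 0 < D₁) (ht2 : t ^ 2 = s ^ 2 + p ^ 2) (hu : u ≤ G * p)
    (hF : F' ≤ F - η / t * u + L / 2 * (η / t * p) ^ 2) (h : G' ≤ G + L * (η / t * p)) :
    u / s - (p ^ 2 * G ^ 2 / ((D₀ + D₁ * G ^ 2) * s)) / 2 - G ^ 2 / s / 4 + (F' - F) / η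
        + D₁ / 2 * (G' ^ 2 / t - G ^ 2 / s)
      ≤ (D₀ / 2 + 2 * (D₁ ^ 2 * (L * η) ^ 2 + D₁ * (L * η) ^ 2 / 2)) * (1 / s - 1 / t)
        + L * η / 2 * (Real.log (t ^ 2) - Real.log (s ^ 2)) := by
  have hst : s ≤ t := abs_le_of_sq_le_sq' (by nlinarith) ht.le |>.2
  have h1 := surrogate_error (M := D₀ + D₁ * G ^ 2) hs ht ht2 (by positivity) hu
  have h2 := gradient_sq_increment (a := L * η) hs hst hG' hD₁.le ht2
    (h.trans_eq (by ring))
  have h3 := log_increment_lower_bound (pow_pos hs 2) (pow_pos ht 2)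
  have h4 : p ^ 2 / t ^ 2 ≤ Real.log (t ^ 2) - Real.log (s ^ 2) := by
    rwa [ht2, add_sub_cancel_left, ← ht2] at h3
  have h5 : (F' - F) / η ≤ - (u / t) + L * η / 2 * (p ^ 2 / t ^ 2) := by
    rw [div_le_iff₀ hη]
    have : (- (u / t) + L * η / 2 * (p ^ 2 / t ^ 2)) * η
        = - (η / t * u) + L / 2 * (η / t * p) ^ 2 := by
      field_simp
    linarith
  have h6 : L * η / 2 * (p ^ 2 / t ^ 2)
      ≤ L * η / 2 * (Real.log (t ^ 2) - Real.log (s ^ 2)) := by gcongr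
  have h7 : u * (1 / s - 1 / t) = u / s - u / t := by ring
  linarith

/-! ### Pathwise estimates along the run. -/

section Run

variable {d : ℕ} {Ω : Type*} {f : EuclideanSpace ℝ (Fin d) → ℝ} {L D₀ D₁ η v₀ : ℝ}
  {x₁ : EuclideanSpace ℝ (Fin d)} {g : ℕ → Ω → EuclideanSpace ℝ (Fin d)}

theorem le_adaGradAccum (k : ℕ) (ω : Ω) : v₀ ≤ adaGradAccum v₀ g k ω := by
  induction k with
  | zero => rfl
  | succ k ih => exact ih.trans (le_add_of_nonneg_right (sq_nonneg _))

theorem adaGradAccum_pos (hv₀ : 0 < v₀) (k : ℕ) (ω : Ω) : 0 < adaGradAccum v₀ g k ω :=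
  hv₀.trans_le (le_adaGradAccum k ω)

theorem adaGradAccum_mono (ω : Ω) : Monotone fun k => adaGradAccum v₀ g k ω :=
  monotone_nat_of_le_succ fun _ => le_add_of_nonneg_right (sq_nonneg _)

theorem adaGradAccum_eq_sum (k : ℕ) (ω : Ω) :
    adaGradAccum v₀ g k ω = v₀ + ∑ i ∈ Finset.range k, ‖g (i + 1) ω‖ ^ 2 := by
  induction k with
  | zero => simp [adaGradAccum]
  | succ k ih => rw [Finset.sum_range_succ, ← add_assoc, ← ih]; rfl

theorem norm_le_sqrt_adaGradAccum (hv₀ : 0 < v₀) (k : ℕ) (ω : Ω) :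
    ‖g (k + 1) ω‖ ≤ √(adaGradAccum v₀ g (k + 1) ω) :=
  Real.le_sqrt_of_sq_le (le_add_of_nonneg_left (adaGradAccum_pos hv₀ k ω).le)

theorem norm_gradient_adaGradIter_succ (hη : 0 < η) (hf : IsLSmooth f L)
    (k : ℕ) (ω : Ω) :
    ‖gradient f (adaGradIter η v₀ x₁ g (k + 2) ω)‖
      ≤ ‖gradient f (adaGradIter η v₀ x₁ g (k + 1) ω)‖
        + L * (η / √(adaGradAccum v₀ g (k + 1) ω) * ‖g (k + 1) ω‖) := by
  have h1 := hf.gradient_lipschitz (adaGradIter η v₀ x₁ g (k + 2) ω)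
    (adaGradIter η v₀ x₁ g (k + 1) ω)
  have h2 : adaGradIter η v₀ x₁ g (k + 2) ω - adaGradIter η v₀ x₁ g (k + 1) ω
      = -((η / √(adaGradAccum v₀ g (k + 1) ω)) • g (k + 1) ω) := by
    simp [adaGradIter]
  rw [h2, norm_neg, norm_smul, Real.norm_of_nonneg (by positivity)] at h1
  have h3 := norm_sub_norm_le (gradient f (adaGradIter η v₀ x₁ g (k + 2) ω))
    (gradient f (adaGradIter η v₀ x₁ g (k + 1) ω))
  linarith

/-- Each step has length at most `η`, since the accumulator already contains the current gradient.
The bound serves only integrability and does not enter the final constant. -/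
theorem norm_gradient_adaGradIter_le (hL : 0 ≤ L) (hη : 0 < η) (hv₀ : 0 < v₀)
    (hf : IsLSmooth f L) (k : ℕ) (ω : Ω) :
    ‖gradient f (adaGradIter η v₀ x₁ g (k + 1) ω)‖ ≤ ‖gradient f x₁‖ + k * (L * η) := by
  induction k with
  | zero => simp [adaGradIter]
  | succ k ih =>
    have h1 := norm_gradient_adaGradIter_succ (v₀ := v₀) (x₁ := x₁) (g := g) hη hf k ω
    have h2 : η / √(adaGradAccum v₀ g (k + 1) ω) * ‖g (k + 1) ω‖ ≤ η := by
      have := Real.sqrt_pos.2 (adaGradAccum_pos (g := g) hv₀ (k + 1) ω)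
      rw [div_mul_eq_mul_div, div_le_iff₀ this]
      gcongr
      exact norm_le_sqrt_adaGradAccum hv₀ k ω
    have h3 := mul_le_mul_of_nonneg_left h2 hL
    push_cast
    linarith

theorem adaGrad_pathwise_potential (hL : 0 ≤ L) (hη : 0 < η) (hv₀ : 0 < v₀) (hD₀ : 0 < D₀)
    (hD₁ : 0 < D₁) (hf : IsLSmooth f L) (K : ℕ) (ω : Ω) :
    ∑ k ∈ Finset.range K,
        (inner ℝ (gradient f (adaGradIter η v₀ x₁ g (k + 1) ω)) (g (k + 1) ω)
            / √(adaGradAccum v₀ g k ω)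
          - (‖g (k + 1) ω‖ ^ 2 * ‖gradient f (adaGradIter η v₀ x₁ g (k + 1) ω)‖ ^ 2
            / ((D₀ + D₁ * ‖gradient f (adaGradIter η v₀ x₁ g (k + 1) ω)‖ ^ 2)
              * √(adaGradAccum v₀ g k ω))) / 2
          - ‖gradient f (adaGradIter η v₀ x₁ g (k + 1) ω)‖ ^ 2 / √(adaGradAccum v₀ g k ω) / 4)
        + (f (adaGradIter η v₀ x₁ g (K + 1) ω) - f x₁) / η
        + D₁ / 2 * (‖gradient f (adaGradIter η v₀ x₁ g (K + 1) ω)‖ ^ 2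
            / √(adaGradAccum v₀ g K ω) - ‖gradient f x₁‖ ^ 2 / √v₀)
      ≤ (D₀ / 2 + 2 * (D₁ ^ 2 * (L * η) ^ 2 + D₁ * (L * η) ^ 2 / 2))
          * (1 / √v₀ - 1 / √(adaGradAccum v₀ g K ω))
        + L * η / 2 * (Real.log (adaGradAccum v₀ g K ω) - Real.log v₀) := by
  induction K with
  | zero => simp [adaGradIter, adaGradAccum]
  | succ K ih =>
    rw [Finset.sum_range_succ]
    have hv := adaGradAccum_pos (g := g) hv₀ K ω
    have hv' := adaGradAccum_pos (g := g) hv₀ (K + 1) ω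
    have hs := Real.sq_sqrt hv.le
    have ht := Real.sq_sqrt hv'.le
    have hF := hf.descent (adaGradIter η v₀ x₁ g (K + 1) ω)
      ((η / √(adaGradAccum v₀ g (K + 1) ω)) • g (K + 1) ω)
    rw [inner_smul_right, norm_smul, Real.norm_of_nonneg (by positivity)] at hF
    have step := adaGrad_potential_step (s := √(adaGradAccum v₀ g K ω))
      (t := √(adaGradAccum v₀ g (K + 1) ω)) (Real.sqrt_pos.2 hv) (p := ‖g (K + 1) ω‖)
      (Real.sqrt_pos.2 hv') (norm_nonneg _) hL hη hD₀ hD₁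
      (by rw [hs, ht]; rfl) (real_inner_le_norm _ _) hF
      (norm_gradient_adaGradIter_succ (v₀ := v₀) (x₁ := x₁) (g := g) hη hf K ω)
    rw [hs, ht] at step
    have e : adaGradIter η v₀ x₁ g (K + 1 + 1) ω = adaGradIter η v₀ x₁ g (K + 1) ω -
      (η / √(adaGradAccum v₀ g (K + 1) ω)) • g (K + 1) ω := rfl
    rw [← e] at step
    have e2 : ∀ a b c : ℝ, (a - c) / η = (b - c) / η + (a - b) / η := fun a b c => by ring
    rw [e2 (f (adaGradIter η v₀ x₁ g (K + 1 + 1) ω)) (f (adaGradIter η v₀ x₁ g (K + 1) ω))]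
    linarith

end Run

/-! ### Conditioning and Cauchy-Schwarz. -/

theorem integral_inner_eq_of_condExp_ae_eq {Ω E : Type*} [NormedAddCommGroup E]
    [InnerProductSpace ℝ E] [CompleteSpace E] {m m0 : MeasurableSpace Ω} {μ : Measure Ω}
    [IsFiniteMeasure μ] (hm : m ≤ m0) {Y Z Z' : Ω → E} {c : ℝ} (hY : StronglyMeasurable[m] Y)
    (hYc : ∀ ω, ‖Y ω‖ ≤ c) (hZ : Integrable Z μ) (hZ' : μ[Z | m] =ᵐ[μ] Z') :
    ∫ ω, inner ℝ (Y ω) (Z ω) ∂μ = ∫ ω, inner ℝ (Y ω) (Z' ω) ∂μ := by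
  have h := condExp_stronglyMeasurable_bilin_of_bound (innerSL ℝ (E := E)) hm hY hZ c
    (ae_of_all _ hYc)
  rw [← integral_condExp hm (f := fun ω => inner ℝ (Y ω) (Z ω))]
  refine integral_congr_ae ?_
  filter_upwards [h, hZ'] with ω h1 h2
  rw [← h2]
  exact h1

theorem integral_mul_le_of_condExp_ae_le {Ω : Type*} {m m0 : MeasurableSpace Ω} {μ : Measure Ω}
    [IsFiniteMeasure μ] (hm : m ≤ m0) {W Z Z' : Ω → ℝ} {c : ℝ} (hW : StronglyMeasurable[m] W)
    (hW0 : ∀ ω, 0 ≤ W ω) (hWc : ∀ ω, W ω ≤ c) (hZ : Integrable Z μ)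
    (hZ' : μ[Z | m] ≤ᵐ[μ] Z') (hWZ' : Integrable (fun ω => W ω * Z' ω) μ) :
    ∫ ω, W ω * Z ω ∂μ ≤ ∫ ω, W ω * Z' ω ∂μ := by
  have h := condExp_stronglyMeasurable_mul_of_bound hm hW hZ c
    (ae_of_all _ fun ω => by rw [Real.norm_of_nonneg (hW0 ω)]; exact hWc ω)
  rw [← integral_condExp hm (f := fun ω => W ω * Z ω)]
  refine integral_mono_ae integrable_condExp hWZ' ?_
  filter_upwards [h, hZ'] with ω h1 h2
  change (μ[W * Z | m]) ω ≤ _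
  rw [h1]
  exact mul_le_mul_of_nonneg_left h2 (hW0 ω)

/-- The integral of `X * t ^ 2 - 2 * Z * t + Y` is a nonnegative quadratic in `t`, so its
discriminant is nonpositive. -/
theorem sq_integral_le_of_sq_le_mul {Ω : Type*} [MeasurableSpace Ω] {μ : Measure Ω}
    {X Y Z : Ω → ℝ} (hX : Integrable X μ) (hY : Integrable Y μ) (hZ : Integrable Z μ)
    (hX0 : ∀ ω, 0 ≤ X ω) (hY0 : ∀ ω, 0 ≤ Y ω) (h : ∀ ω, Z ω ^ 2 ≤ X ω * Y ω) :
    (∫ ω, Z ω ∂μ) ^ 2 ≤ (∫ ω, X ω ∂μ) * ∫ ω, Y ω ∂μ := by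
  have key : ∀ t : ℝ, 0 ≤ (∫ ω, X ω ∂μ) * (t * t) + (-2 * ∫ ω, Z ω ∂μ) * t + ∫ ω, Y ω ∂μ := by
    intro t
    have h0 : 0 ≤ ∫ ω, (X ω * (t * t) + (-2 * Z ω) * t + Y ω) ∂μ := by
      refine integral_nonneg fun ω => ?_
      have hd : (2 * Z ω) ^ 2 ≤ 4 * (X ω * Y ω) := by nlinarith [h ω]
      change 0 ≤ X ω * (t * t) + (-2 * Z ω) * t + Y ω
      rcases (hX0 ω).eq_or_lt with h1 | h1
      · have h2 : Z ω = 0 := by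
          have := h ω
          rw [← h1, zero_mul] at this
          exact pow_eq_zero_iff two_ne_zero |>.1 (le_antisymm this (sq_nonneg _))
        rw [← h1, h2]
        simpa using hY0 ω
      · have : X ω * (X ω * (t * t) + (-2 * Z ω) * t + Y ω)
            = (X ω * t - Z ω) ^ 2 + (X ω * Y ω - Z ω ^ 2) := by ring
        refine nonneg_of_mul_nonneg_right (?_ : 0 ≤ X ω * _) h1
        rw [this]
        have := h ω
        have := sq_nonneg (X ω * t - Z ω)
        linarith
    rw [integral_add (f := fun ω => X ω * (t * t) + (-2 * Z ω) * t)
      ((hX.mul_const _).add ((hZ.const_mul _).mul_const _)) hY,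
      integral_add (hX.mul_const _) ((hZ.const_mul _).mul_const _), integral_mul_const,
      integral_mul_const, integral_const_mul] at h0
    exact h0
  have := discrim_le_zero key
  rw [discrim] at this
  linarith

/-! ### Predictability and bounds of the weights. -/

section History

variable {d : ℕ} {Ω : Type*} {f : EuclideanSpace ℝ (Fin d) → ℝ} {L D₀ D₁ η v₀ : ℝ}
  {x₁ : EuclideanSpace ℝ (Fin d)} {g : ℕ → Ω → EuclideanSpace ℝ (Fin d)}

theorem gradHistory_le [m0 : MeasurableSpace Ω] (hg : ∀ k, 1 ≤ k → Measurable (g k)) (k : ℕ) :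
    gradHistory g k ≤ m0 :=
  iSup₂_le fun j hj => (hg j (Finset.mem_Ico.1 hj).1).comap_le

theorem gradHistory_mono {j k : ℕ} (h : j ≤ k) : gradHistory g j ≤ gradHistory g k :=
  biSup_mono fun _ hi => Finset.Ico_subset_Ico_right h hi

theorem measurable_gradHistory {j k : ℕ} (hj : 1 ≤ j) (hk : j < k) :
    Measurable[gradHistory g k] (g j) :=
  measurable_iff_comap_le.2 (le_iSup₂_of_le j (Finset.mem_Ico.2 ⟨hj, hk⟩) le_rfl)

theorem measurable_adaGradAccum (k : ℕ) :
    Measurable[gradHistory g (k + 1)] (adaGradAccum v₀ g k) := by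
  induction k with
  | zero => exact measurable_const
  | succ k ih =>
    have h1 : Measurable[gradHistory g (k + 2)] (g (k + 1)) :=
      measurable_gradHistory (Nat.le_add_left 1 k) (Nat.lt_succ_self _)
    have h2 : Measurable[gradHistory g (k + 2)] (fun ω => ‖g (k + 1) ω‖ ^ 2) :=
      (measurable_norm.comp h1).pow_const 2
    exact (ih.mono (gradHistory_mono (Nat.le_succ _)) le_rfl).add h2

theorem measurable_adaGradIter (k : ℕ) :
    Measurable[gradHistory g (k + 1)] (adaGradIter η v₀ x₁ g (k + 1)) := by
  induction k with
  | zero => exact measurable_const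
  | succ k ih =>
    have h1 : Measurable[gradHistory g (k + 2)] (g (k + 1)) :=
      measurable_gradHistory (Nat.le_add_left 1 k) (Nat.lt_succ_self _)
    have h2 : Measurable[gradHistory g (k + 2)] (adaGradAccum v₀ g (k + 1)) :=
      measurable_adaGradAccum (k + 1)
    have h3 : Measurable[gradHistory g (k + 2)]
        (fun ω => η / √(adaGradAccum v₀ g (k + 1) ω)) := h2.sqrt.const_div η
    exact (ih.mono (gradHistory_mono (Nat.le_succ _)) le_rfl).sub (h3.smul h1)

/-- The gradient at the `k`-th point of the run, counted from `k = 0`. -/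
noncomputable abbrev runGradient (f : EuclideanSpace ℝ (Fin d) → ℝ) (η v₀ : ℝ)
    (x₁ : EuclideanSpace ℝ (Fin d)) (g : ℕ → Ω → EuclideanSpace ℝ (Fin d)) (k : ℕ) (ω : Ω) :
    EuclideanSpace ℝ (Fin d) :=
  gradient f (adaGradIter η v₀ x₁ g (k + 1) ω)

theorem measurable_runGradient (hL : 0 ≤ L) (hf : IsLSmooth f L) (k : ℕ) :
    Measurable[gradHistory g (k + 1)] (runGradient f η v₀ x₁ g k) :=
  (hf.continuous_gradient hL).measurable.comp (measurable_adaGradIter k)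

/-- The scaled squared gradient `‖∇ f (x (k + 1))‖ ^ 2 / √(v k)`. -/
noncomputable abbrev scaledGradSq (f : EuclideanSpace ℝ (Fin d) → ℝ) (η v₀ : ℝ)
    (x₁ : EuclideanSpace ℝ (Fin d)) (g : ℕ → Ω → EuclideanSpace ℝ (Fin d)) (k : ℕ) (ω : Ω) : ℝ :=
  ‖runGradient f η v₀ x₁ g k ω‖ ^ 2 / √(adaGradAccum v₀ g k ω)

/-- The weight `‖∇ f‖ ^ 2 / ((D₀ + D₁ * ‖∇ f‖ ^ 2) * √(v k))` at the point `x (k + 1)`. -/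
noncomputable abbrev noiseWeight (f : EuclideanSpace ℝ (Fin d) → ℝ) (D₀ D₁ η v₀ : ℝ)
    (x₁ : EuclideanSpace ℝ (Fin d)) (g : ℕ → Ω → EuclideanSpace ℝ (Fin d)) (k : ℕ) (ω : Ω) : ℝ :=
  ‖runGradient f η v₀ x₁ g k ω‖ ^ 2
    / ((D₀ + D₁ * ‖runGradient f η v₀ x₁ g k ω‖ ^ 2) * √(adaGradAccum v₀ g k ω))

theorem sqrt_le_sqrt_adaGradAccum (k : ℕ) (ω : Ω) : √v₀ ≤ √(adaGradAccum v₀ g k ω) :=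
  Real.sqrt_le_sqrt (le_adaGradAccum k ω)

theorem norm_sq_runGradient_le (hL : 0 ≤ L) (hη : 0 < η) (hv₀ : 0 < v₀) (hf : IsLSmooth f L)
    (k : ℕ) (ω : Ω) :
    ‖runGradient f η v₀ x₁ g k ω‖ ^ 2 ≤ (‖gradient f x₁‖ + k * (L * η)) ^ 2 := by
  gcongr
  exact norm_gradient_adaGradIter_le hL hη hv₀ hf k ω

theorem scaledGradSq_le (hL : 0 ≤ L) (hη : 0 < η) (hv₀ : 0 < v₀) (hf : IsLSmooth f L)
    (k : ℕ) (ω : Ω) :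
    scaledGradSq f η v₀ x₁ g k ω ≤ (‖gradient f x₁‖ + k * (L * η)) ^ 2 / √v₀ := by
  have := Real.sqrt_pos.2 hv₀
  exact div_le_div₀ (sq_nonneg _) (norm_sq_runGradient_le hL hη hv₀ hf k ω) this
    (sqrt_le_sqrt_adaGradAccum k ω)

theorem noiseWeight_le (hv₀ : 0 < v₀) (hD₀ : 0 < D₀) (hD₁ : 0 < D₁) (k : ℕ) (ω : Ω) :
    noiseWeight f D₀ D₁ η v₀ x₁ g k ω ≤ 1 / (D₁ * √v₀) := by
  have h0 := Real.sqrt_pos.2 hv₀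
  have h1 := sqrt_le_sqrt_adaGradAccum (v₀ := v₀) (g := g) k ω
  rw [noiseWeight, div_le_div_iff₀ (mul_pos (by positivity) (h0.trans_le h1)) (by positivity),
    one_mul]
  calc _ = D₁ * ‖runGradient f η v₀ x₁ g k ω‖ ^ 2 * √v₀ := by ring
    _ ≤ _ := by gcongr; linarith

theorem noiseWeight_mul (hD₀ : 0 < D₀) (hD₁ : 0 < D₁) (k : ℕ) (ω : Ω) :
    noiseWeight f D₀ D₁ η v₀ x₁ g k ω * (D₀ + D₁ * ‖runGradient f η v₀ x₁ g k ω‖ ^ 2)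
      = scaledGradSq f η v₀ x₁ g k ω := by
  have : 0 < D₀ + D₁ * ‖runGradient f η v₀ x₁ g k ω‖ ^ 2 := by positivity
  rw [noiseWeight, scaledGradSq, mul_comm (D₀ + _), ← div_div, div_mul_cancel₀ _ this.ne']

theorem measurable_noiseWeight (hL : 0 ≤ L) (hf : IsLSmooth f L) (k : ℕ) :
    Measurable[gradHistory g (k + 1)] (noiseWeight f D₀ D₁ η v₀ x₁ g k) := by
  have h1 : Measurable[gradHistory g (k + 1)] fun ω => ‖runGradient f η v₀ x₁ g k ω‖ ^ 2 :=
    (measurable_norm.comp (measurable_runGradient hL hf k)).pow_const 2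
  exact h1.div (((h1.const_mul D₁).const_add D₀).mul (measurable_adaGradAccum k).sqrt)

theorem noiseWeight_nonneg (hD₀ : 0 < D₀) (hD₁ : 0 < D₁) (k : ℕ) (ω : Ω) :
    0 ≤ noiseWeight f D₀ D₁ η v₀ x₁ g k ω := by
  positivity

theorem norm_scaledGradient_le (hL : 0 ≤ L) (hη : 0 < η) (hv₀ : 0 < v₀) (hf : IsLSmooth f L)
    (k : ℕ) (ω : Ω) :
    ‖(√(adaGradAccum v₀ g k ω))⁻¹ • runGradient f η v₀ x₁ g k ω‖
      ≤ (√v₀)⁻¹ * (‖gradient f x₁‖ + k * (L * η)) := by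
  have h0 := Real.sqrt_pos.2 hv₀
  rw [norm_smul, norm_inv, Real.norm_of_nonneg (Real.sqrt_nonneg _)]
  exact mul_le_mul (inv_anti₀ h0 (sqrt_le_sqrt_adaGradAccum k ω))
    (norm_gradient_adaGradIter_le hL hη hv₀ hf k ω) (norm_nonneg _) (by positivity)

theorem measurable_scaledGradient (hL : 0 ≤ L) (hf : IsLSmooth f L) (k : ℕ) :
    Measurable[gradHistory g (k + 1)]
      (fun ω => (√(adaGradAccum v₀ g k ω))⁻¹ • runGradient f η v₀ x₁ g k ω) := by
  have h1 : Measurable[gradHistory g (k + 1)] (fun ω => (√(adaGradAccum v₀ g k ω))⁻¹) :=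
    (measurable_adaGradAccum k).sqrt.inv
  exact h1.smul (measurable_runGradient hL hf k)

end History

/-! ### Integrability and the bound on the expected sum of scaled gradients. -/

section Expectation

variable {d : ℕ} {Ω : Type*} [m0 : MeasurableSpace Ω] {μ : Measure Ω} [IsProbabilityMeasure μ]
  {f : EuclideanSpace ℝ (Fin d) → ℝ} {L D₀ D₁ η v₀ : ℝ}
  {x₁ : EuclideanSpace ℝ (Fin d)} {g : ℕ → Ω → EuclideanSpace ℝ (Fin d)}

namespace IsAffineStochasticGradient

theorem integrable (h : IsAffineStochasticGradient μ f D₀ D₁ η v₀ x₁ g) (k : ℕ) :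
    Integrable (g (k + 1)) μ :=
  (h.memLp (k + 1) (Nat.le_add_left 1 k)).integrable one_le_two

theorem integrable_norm_sq (h : IsAffineStochasticGradient μ f D₀ D₁ η v₀ x₁ g) (k : ℕ) :
    Integrable (fun ω => ‖g (k + 1) ω‖ ^ 2) μ :=
  (h.memLp (k + 1) (Nat.le_add_left 1 k)).norm.integrable_sq

theorem gradHistory_le (h : IsAffineStochasticGradient μ f D₀ D₁ η v₀ x₁ g) (k : ℕ) :
    gradHistory g k ≤ m0 :=
  _root_.gradHistory_le h.measurable k

theorem measurable_accum (h : IsAffineStochasticGradient μ f D₀ D₁ η v₀ x₁ g) (k : ℕ) :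
    Measurable (adaGradAccum v₀ g k) :=
  (measurable_adaGradAccum k).mono (h.gradHistory_le _) le_rfl

theorem measurable_gradient (hL : 0 ≤ L) (hf : IsLSmooth f L)
    (h : IsAffineStochasticGradient μ f D₀ D₁ η v₀ x₁ g) (k : ℕ) :
    Measurable (runGradient f η v₀ x₁ g k) :=
  (measurable_runGradient hL hf k).mono (h.gradHistory_le _) le_rfl

theorem integrable_accum (h : IsAffineStochasticGradient μ f D₀ D₁ η v₀ x₁ g) (k : ℕ) :
    Integrable (adaGradAccum v₀ g k) μ := by
  rw [show adaGradAccum v₀ g k = fun ω => v₀ + ∑ i ∈ Finset.range k, ‖g (i + 1) ω‖ ^ 2 from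
    funext (adaGradAccum_eq_sum k)]
  exact (integrable_const _).add (integrable_finsetSum _ fun i _ => h.integrable_norm_sq i)

theorem integrable_sqrt_accum (hv₀ : 0 < v₀)
    (h : IsAffineStochasticGradient μ f D₀ D₁ η v₀ x₁ g) (k : ℕ) :
    Integrable (fun ω => √(adaGradAccum v₀ g k ω)) μ := by
  refine Integrable.mono' ((integrable_const (1 : ℝ)).add (h.integrable_accum k))
    (h.measurable_accum k).sqrt.aestronglyMeasurable (ae_of_all _ fun ω => ?_)
  have hv := adaGradAccum_pos (g := g) hv₀ k ω
  rw [Real.norm_of_nonneg (Real.sqrt_nonneg _)]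
  refine Real.sqrt_le_iff.2 ⟨(by change (0 : ℝ) ≤ 1 + adaGradAccum v₀ g k ω; positivity), ?_⟩
  change _ ≤ (1 + adaGradAccum v₀ g k ω) ^ 2
  nlinarith

theorem integrable_log_accum (hv₀ : 0 < v₀)
    (h : IsAffineStochasticGradient μ f D₀ D₁ η v₀ x₁ g) (k : ℕ) :
    Integrable (fun ω => Real.log (adaGradAccum v₀ g k ω)) μ := by
  refine Integrable.mono' ((integrable_const |Real.log v₀|).add (h.integrable_accum k))
    (h.measurable_accum k).log.aestronglyMeasurable (ae_of_all _ fun ω => ?_)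
  have hv := adaGradAccum_pos (g := g) hv₀ k ω
  have h1 := Real.log_le_log hv₀ (le_adaGradAccum (g := g) k ω)
  have h2 := Real.log_le_sub_one_of_pos hv
  have h3 := neg_abs_le (Real.log v₀)
  have h4 := abs_nonneg (Real.log v₀)
  rw [Real.norm_eq_abs]
  change _ ≤ |Real.log v₀| + adaGradAccum v₀ g k ω
  exact abs_le.2 ⟨by linarith, by linarith⟩

theorem integrable_scaledGradSq (hL : 0 ≤ L) (hη : 0 < η) (hv₀ : 0 < v₀) (hf : IsLSmooth f L)
    (h : IsAffineStochasticGradient μ f D₀ D₁ η v₀ x₁ g) (k : ℕ) :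
    Integrable (scaledGradSq f η v₀ x₁ g k) μ := by
  refine Integrable.of_bound (((h.measurable_gradient hL hf k).norm.pow_const 2).div
    (h.measurable_accum k).sqrt).aestronglyMeasurable
    ((‖gradient f x₁‖ + k * (L * η)) ^ 2 / √v₀) (ae_of_all _ fun ω => ?_)
  rw [Real.norm_of_nonneg (by positivity)]
  exact scaledGradSq_le hL hη hv₀ hf k ω

theorem integrable_noiseWeight_mul (hL : 0 ≤ L) (hv₀ : 0 < v₀) (hD₀ : 0 < D₀) (hD₁ : 0 < D₁)
    (hf : IsLSmooth f L) (h : IsAffineStochasticGradient μ f D₀ D₁ η v₀ x₁ g) (k : ℕ) :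
    Integrable (fun ω => noiseWeight f D₀ D₁ η v₀ x₁ g k ω * ‖g (k + 1) ω‖ ^ 2) μ := by
  refine (h.integrable_norm_sq k).bdd_mul (c := 1 / (D₁ * √v₀))
    ((measurable_noiseWeight hL hf k).mono (h.gradHistory_le _) le_rfl).aestronglyMeasurable
    (ae_of_all _ fun ω => ?_)
  rw [Real.norm_of_nonneg (noiseWeight_nonneg hD₀ hD₁ k ω)]
  exact noiseWeight_le hv₀ hD₀ hD₁ k ω

/-- The denominator of the weight contains the affine bound on the conditional second moment, so the
two cancel after conditioning. -/
theorem integral_noiseWeight_mul_le (hL : 0 ≤ L) (hη : 0 < η) (hv₀ : 0 < v₀) (hD₀ : 0 < D₀)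
    (hD₁ : 0 < D₁) (hf : IsLSmooth f L) (h : IsAffineStochasticGradient μ f D₀ D₁ η v₀ x₁ g)
    (k : ℕ) :
    ∫ ω, noiseWeight f D₀ D₁ η v₀ x₁ g k ω * ‖g (k + 1) ω‖ ^ 2 ∂μ
      ≤ ∫ ω, scaledGradSq f η v₀ x₁ g k ω ∂μ := by
  have e : (fun ω => noiseWeight f D₀ D₁ η v₀ x₁ g k ω
      * (D₀ + D₁ * ‖runGradient f η v₀ x₁ g k ω‖ ^ 2)) = scaledGradSq f η v₀ x₁ g k :=
    funext fun ω => noiseWeight_mul hD₀ hD₁ k ω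
  rw [← e]
  refine integral_mul_le_of_condExp_ae_le (h.gradHistory_le (k + 1))
    (measurable_noiseWeight hL hf k).stronglyMeasurable (noiseWeight_nonneg hD₀ hD₁ k)
    (noiseWeight_le hv₀ hD₀ hD₁ k) (h.integrable_norm_sq k) (h.affine (k + 1) (by lia)) ?_
  rw [e]
  exact h.integrable_scaledGradSq hL hη hv₀ hf k

/-- The part of the noise that is bounded by `D₀`, selected by the weight `D₀ / (D₀ + D₁ G ^ 2)`. -/
theorem integral_bounded_noise_le (hL : 0 ≤ L) (hD₀ : 0 < D₀)
    (hD₁ : 0 < D₁) (hf : IsLSmooth f L) (h : IsAffineStochasticGradient μ f D₀ D₁ η v₀ x₁ g)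
    (k : ℕ) :
    ∫ ω, D₀ / (D₀ + D₁ * ‖runGradient f η v₀ x₁ g k ω‖ ^ 2) * ‖g (k + 1) ω‖ ^ 2 ∂μ ≤ D₀ := by
  have e : (fun ω => D₀ / (D₀ + D₁ * ‖runGradient f η v₀ x₁ g k ω‖ ^ 2)
      * (D₀ + D₁ * ‖runGradient f η v₀ x₁ g k ω‖ ^ 2)) = fun _ => D₀ :=
    funext fun ω => div_mul_cancel₀ _ (by positivity)
  have hm : Measurable[gradHistory g (k + 1)]
      fun ω => D₀ / (D₀ + D₁ * ‖runGradient f η v₀ x₁ g k ω‖ ^ 2) := by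
    have h1 : Measurable[gradHistory g (k + 1)] fun ω => ‖runGradient f η v₀ x₁ g k ω‖ ^ 2 :=
      (measurable_norm.comp (measurable_runGradient hL hf k)).pow_const 2
    exact ((h1.const_mul D₁).const_add D₀).const_div D₀
  have := integral_mul_le_of_condExp_ae_le (c := 1) (h.gradHistory_le (k + 1))
    hm.stronglyMeasurable (fun ω => by positivity)
    (fun ω => div_le_one_of_le₀ (le_add_of_nonneg_right (by positivity)) (by positivity))
    (h.integrable_norm_sq k) (h.affine (k + 1) (by lia)) (by
      rw [e]; exact integrable_const _)
  rw [e] at this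
  simpa using this

theorem integrable_bounded_noise (hL : 0 ≤ L) (hD₀ : 0 < D₀)
    (hD₁ : 0 < D₁) (hf : IsLSmooth f L) (h : IsAffineStochasticGradient μ f D₀ D₁ η v₀ x₁ g)
    (k : ℕ) : Integrable
      (fun ω => D₀ / (D₀ + D₁ * ‖runGradient f η v₀ x₁ g k ω‖ ^ 2) * ‖g (k + 1) ω‖ ^ 2) μ := by
  refine (h.integrable_norm_sq k).bdd_mul (c := 1) (((((h.measurable_gradient hL hf k).norm.pow_const
    2).const_mul D₁).const_add D₀).const_div D₀).aestronglyMeasurable (ae_of_all _ fun ω => ?_)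
  rw [Real.norm_of_nonneg (by positivity)]
  exact div_le_one_of_le₀ (le_add_of_nonneg_right (by positivity)) (by positivity)

theorem integrable_inner (hL : 0 ≤ L) (hη : 0 < η) (hv₀ : 0 < v₀) (hf : IsLSmooth f L)
    (h : IsAffineStochasticGradient μ f D₀ D₁ η v₀ x₁ g) (k : ℕ) :
    Integrable (fun ω => inner ℝ (runGradient f η v₀ x₁ g k ω) (g (k + 1) ω)
      / √(adaGradAccum v₀ g k ω)) μ := by
  have := (innerSL ℝ (E := EuclideanSpace ℝ (Fin d))).integrable_of_bilin_of_bdd_left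
    ((√v₀)⁻¹ * (‖gradient f x₁‖ + k * (L * η)))
    ((measurable_scaledGradient (v₀ := v₀) (η := η) (x₁ := x₁) (g := g) hL hf k).mono
      (h.gradHistory_le _) le_rfl).aestronglyMeasurable
    (ae_of_all _ (norm_scaledGradient_le hL hη hv₀ hf k)) (h.integrable k)
  refine this.congr (ae_of_all _ fun ω => ?_)
  change inner ℝ ((√(adaGradAccum v₀ g k ω))⁻¹ • runGradient f η v₀ x₁ g k ω) (g (k + 1) ω) = _
  rw [real_inner_smul_left, inv_mul_eq_div]

theorem integral_inner_eq (hL : 0 ≤ L) (hη : 0 < η) (hv₀ : 0 < v₀) (hf : IsLSmooth f L)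
    (h : IsAffineStochasticGradient μ f D₀ D₁ η v₀ x₁ g) (k : ℕ) :
    ∫ ω, inner ℝ (runGradient f η v₀ x₁ g k ω) (g (k + 1) ω) / √(adaGradAccum v₀ g k ω) ∂μ
      = ∫ ω, scaledGradSq f η v₀ x₁ g k ω ∂μ := by
  have := integral_inner_eq_of_condExp_ae_eq (h.gradHistory_le (k + 1))
    (measurable_scaledGradient (v₀ := v₀) (η := η) (x₁ := x₁) hL hf k).stronglyMeasurable
    (norm_scaledGradient_le hL hη hv₀ hf k) (h.integrable k) (h.unbiased (k + 1) (by lia))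
  simpa only [real_inner_smul_left, real_inner_self_eq_norm_sq, inv_mul_eq_div] using this

theorem integral_sum_scaledGradSq_le (hL : 0 ≤ L) (hη : 0 < η) (hv₀ : 0 < v₀) (hD₀ : 0 < D₀)
    (hD₁ : 0 < D₁) (hf : IsLSmooth f L) (hb : BddBelow (Set.range f))
    (h : IsAffineStochasticGradient μ f D₀ D₁ η v₀ x₁ g) (K : ℕ) :
    ∫ ω, ∑ k ∈ Finset.range K, scaledGradSq f η v₀ x₁ g k ω ∂μ
      ≤ adaGradBracket f L D₀ D₁ η v₀ x₁
          ((∫ ω, Real.log (adaGradAccum v₀ g K ω) ∂μ) - Real.log v₀) := by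
  have hpath : ∀ ω, ∑ k ∈ Finset.range K,
      (inner ℝ (runGradient f η v₀ x₁ g k ω) (g (k + 1) ω) / √(adaGradAccum v₀ g k ω)
        - noiseWeight f D₀ D₁ η v₀ x₁ g k ω * ‖g (k + 1) ω‖ ^ 2 / 2
        - scaledGradSq f η v₀ x₁ g k ω / 4)
      ≤ adaGradBracket f L D₀ D₁ η v₀ x₁ (- Real.log v₀) / 4
        + L * η / 2 * Real.log (adaGradAccum v₀ g K ω) := by
    intro ω
    have h1 := adaGrad_pathwise_potential (x₁ := x₁) (g := g) hL hη hv₀ hD₀ hD₁ hf K ω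
    have h2 : (⨅ x, f x) ≤ f (adaGradIter η v₀ x₁ g (K + 1) ω) := ciInf_le hb _
    have h3 : -((f x₁ - ⨅ x, f x) / η) ≤ (f (adaGradIter η v₀ x₁ g (K + 1) ω) - f x₁) / η := by
      rw [← neg_div]
      gcongr
      linarith
    -- The terminal terms of the telescoping sums have a favourable sign and are dropped.
    have h4 : 0 ≤ D₁ / 2 * (‖gradient f (adaGradIter η v₀ x₁ g (K + 1) ω)‖ ^ 2
        / √(adaGradAccum v₀ g K ω)) := by positivity
    have h5 : 0 ≤ (D₀ / 2 + 2 * (D₁ ^ 2 * (L * η) ^ 2 + D₁ * (L * η) ^ 2 / 2))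
        * (1 / √(adaGradAccum v₀ g K ω)) := by positivity
    have h6 : adaGradBracket f L D₀ D₁ η v₀ x₁ (- Real.log v₀) / 4
        = (f x₁ - ⨅ x, f x) / η + D₁ / 2 * (‖gradient f x₁‖ ^ 2 / √v₀)
          + (D₀ / 2 + 2 * (D₁ ^ 2 * (L * η) ^ 2 + D₁ * (L * η) ^ 2 / 2)) * (1 / √v₀)
          - L * η / 2 * Real.log v₀ := by
      rw [adaGradBracket, adaGradXiZero]
      ring
    have h7 : ∀ k, noiseWeight f D₀ D₁ η v₀ x₁ g k ω * ‖g (k + 1) ω‖ ^ 2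
        = ‖g (k + 1) ω‖ ^ 2 * ‖runGradient f η v₀ x₁ g k ω‖ ^ 2
          / ((D₀ + D₁ * ‖runGradient f η v₀ x₁ g k ω‖ ^ 2) * √(adaGradAccum v₀ g k ω)) :=
      fun k => by rw [noiseWeight, div_mul_eq_mul_div, mul_comm (‖g (k + 1) ω‖ ^ 2)]
    simp only [h7]
    rw [h6]
    linarith
  have hi1 := fun k => h.integrable_inner hL hη hv₀ hf k
  have hi2 := fun k => (h.integrable_noiseWeight_mul hL hv₀ hD₀ hD₁ hf k).div_const 2
  have hi3 := fun k => (h.integrable_scaledGradSq hL hη hv₀ hf k).div_const 4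
  have hi4 := (h.integrable_log_accum hv₀ K).const_mul (L * η / 2)
  have hint := integral_mono (μ := μ)
    (integrable_finsetSum (Finset.range K) fun k _ => ((hi1 k).sub (hi2 k)).sub (hi3 k))
    ((integrable_const (adaGradBracket f L D₀ D₁ η v₀ x₁ (- Real.log v₀) / 4)).add hi4) (by
      intro ω
      simpa using hpath ω)
  rw [integral_finsetSum _ fun k _ => ((hi1 k).sub (hi2 k)).sub (hi3 k),
    integral_add' (integrable_const _) hi4, integral_const_mul, integral_const, probReal_univ,
    one_smul] at hint
  rw [integral_finsetSum _ fun k _ => h.integrable_scaledGradSq hL hη hv₀ hf k]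
  -- The balance of coefficients: 1 - 1/2 - 1/4 = 1/4.
  have hk : ∀ k, (∫ ω, scaledGradSq f η v₀ x₁ g k ω ∂μ) / 4 ≤ ∫ ω,
      (((fun ω => inner ℝ (runGradient f η v₀ x₁ g k ω) (g (k + 1) ω) / √(adaGradAccum v₀ g k ω)
          : Ω → ℝ) - fun ω => noiseWeight f D₀ D₁ η v₀ x₁ g k ω * ‖g (k + 1) ω‖ ^ 2 / 2)
        - fun ω => scaledGradSq f η v₀ x₁ g k ω / 4 : Ω → ℝ) ω ∂μ := by
    intro k
    rw [integral_sub' ((hi1 k).sub (hi2 k)) (hi3 k), integral_sub' (hi1 k) (hi2 k),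
      h.integral_inner_eq hL hη hv₀ hf k, integral_div, integral_div]
    have := h.integral_noiseWeight_mul_le hL hη hv₀ hD₀ hD₁ hf k
    linarith
  have hs := (Finset.sum_le_sum fun k (_ : k ∈ Finset.range K) => hk k).trans hint
  rw [← Finset.sum_div] at hs
  have e : ∀ a b : ℝ, adaGradBracket f L D₀ D₁ η v₀ x₁ (a - b)
      = adaGradBracket f L D₀ D₁ η v₀ x₁ (-b) + 2 * L * η * a := fun a b => by
    rw [adaGradBracket, adaGradBracket]
    ring
  rw [e]
  linarith

end IsAffineStochasticGradient

end Expectation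

/-! ### The smallest gradient and the size of the accumulator. -/

section MinGradient

variable {d : ℕ} {Ω : Type*} {f : EuclideanSpace ℝ (Fin d) → ℝ} {L D₀ D₁ η v₀ : ℝ}
  {x₁ : EuclideanSpace ℝ (Fin d)} {g : ℕ → Ω → EuclideanSpace ℝ (Fin d)}

theorem adaGradMinGradSq_le {K : ℕ} (hK : 1 ≤ K) {k : ℕ} (hk : k < K) (ω : Ω) :
    adaGradMinGradSq f η v₀ x₁ g K hK ω ≤ ‖runGradient f η v₀ x₁ g k ω‖ ^ 2 :=
  Finset.inf'_le _ (Finset.mem_Icc.2 ⟨Nat.le_add_left 1 k, hk⟩)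

theorem adaGradMinGradSq_nonneg {K : ℕ} (hK : 1 ≤ K) (ω : Ω) :
    0 ≤ adaGradMinGradSq f η v₀ x₁ g K hK ω :=
  Finset.le_inf' _ _ fun _ _ => sq_nonneg _

theorem adaGradMinGradSq_le_initial {K : ℕ} (hK : 1 ≤ K) (ω : Ω) :
    adaGradMinGradSq f η v₀ x₁ g K hK ω ≤ ‖gradient f x₁‖ ^ 2 :=
  -- The second `hK` is read as `0 < K`: index 0 is the deterministic starting point.
  adaGradMinGradSq_le hK hK ω

theorem mul_adaGradMinGradSq_le (hv₀ : 0 < v₀) {K : ℕ} (hK : 1 ≤ K) (ω : Ω) :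
    K * adaGradMinGradSq f η v₀ x₁ g K hK ω
      ≤ √(adaGradAccum v₀ g K ω) * ∑ k ∈ Finset.range K, scaledGradSq f η v₀ x₁ g k ω := by
  rw [Finset.mul_sum, ← nsmul_eq_mul]
  nth_rewrite 1 [← Finset.card_range K]
  refine Finset.card_nsmul_le_sum _ _ _ fun k hk => ?_
  have hk := Finset.mem_range.1 hk
  refine (adaGradMinGradSq_le hK hk ω).trans ?_
  have h0 := Real.sqrt_pos.2 (adaGradAccum_pos (g := g) hv₀ k ω)
  rw [← mul_div_assoc, le_div_iff₀ h0, mul_comm]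
  exact mul_le_mul_of_nonneg_right (Real.sqrt_le_sqrt (adaGradAccum_mono ω hk.le)) (sq_nonneg _)

/-- Split of `√(v K)` into the noise part selected by the weight `D₀ / (D₀ + D₁ G ^ 2)` and the
gradient part. -/
theorem sqrt_adaGradAccum_le (hv₀ : 0 < v₀) (hD₀ : 0 < D₀) (hD₁ : 0 < D₁) (K : ℕ) (ω : Ω) :
    √(adaGradAccum v₀ g K ω)
      ≤ √(v₀ + ∑ k ∈ Finset.range K,
          D₀ / (D₀ + D₁ * ‖runGradient f η v₀ x₁ g k ω‖ ^ 2) * ‖g (k + 1) ω‖ ^ 2)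
        + D₁ * ∑ k ∈ Finset.range K,
          noiseWeight f D₀ D₁ η v₀ x₁ g k ω * ‖g (k + 1) ω‖ ^ 2 := by
  set w : ℕ → ℝ := fun k => D₀ / (D₀ + D₁ * ‖runGradient f η v₀ x₁ g k ω‖ ^ 2)
  set A := v₀ + ∑ k ∈ Finset.range K, w k * ‖g (k + 1) ω‖ ^ 2
  set s := √(adaGradAccum v₀ g K ω)
  have hw0 : ∀ k, 0 ≤ w k := fun k => by positivity
  have hw1 : ∀ k, w k ≤ 1 := fun k =>
    div_le_one_of_le₀ (le_add_of_nonneg_right (by positivity)) (by positivity)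
  have hs : 0 < s := Real.sqrt_pos.2 (adaGradAccum_pos hv₀ K ω)
  have hA : 0 ≤ A := add_nonneg hv₀.le (Finset.sum_nonneg fun k _ =>
    mul_nonneg (hw0 k) (sq_nonneg _))
  have hs2 : s ^ 2 = v₀ + ∑ i ∈ Finset.range K, ‖g (i + 1) ω‖ ^ 2 := by
    rw [← adaGradAccum_eq_sum, Real.sq_sqrt (adaGradAccum_pos hv₀ K ω).le]
  have hAs : √A ≤ s := by
    refine Real.sqrt_le_sqrt ?_
    rw [adaGradAccum_eq_sum]
    refine add_le_add_right (Finset.sum_le_sum fun k _ => ?_) v₀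
    exact mul_le_of_le_one_left (sq_nonneg _) (hw1 k)
  -- The complementary weight `1 - w k` carries a factor `√(v k) ≤ s`. Together with `A ≤ s * √A`,
  -- this lets one factor `s` be divided out.
  have hrest : s ^ 2 - A ≤ s * (D₁ * ∑ k ∈ Finset.range K,
      noiseWeight f D₀ D₁ η v₀ x₁ g k ω * ‖g (k + 1) ω‖ ^ 2) := by
    rw [hs2, add_sub_add_left_eq_sub, ← Finset.sum_sub_distrib, Finset.mul_sum, Finset.mul_sum]
    refine Finset.sum_le_sum fun k hk => ?_
    have hk := (Finset.mem_range.1 hk).le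
    have h0 := Real.sqrt_pos.2 (adaGradAccum_pos (g := g) hv₀ k ω)
    have h1 : √(adaGradAccum v₀ g k ω) ≤ s := Real.sqrt_le_sqrt (adaGradAccum_mono ω hk)
    have hM : 0 < D₀ + D₁ * ‖runGradient f η v₀ x₁ g k ω‖ ^ 2 := by positivity
    have e : 1 - w k = D₁ * (noiseWeight f D₀ D₁ η v₀ x₁ g k ω * √(adaGradAccum v₀ g k ω)) := by
      simp only [w, noiseWeight]
      field_simp
      ring
    have h2 := noiseWeight_nonneg (f := f) (η := η) (v₀ := v₀) (x₁ := x₁) (g := g) hD₀ hD₁ k ω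
    calc ‖g (k + 1) ω‖ ^ 2 - w k * ‖g (k + 1) ω‖ ^ 2 = (1 - w k) * ‖g (k + 1) ω‖ ^ 2 := by ring
      _ = D₁ * (noiseWeight f D₀ D₁ η v₀ x₁ g k ω * √(adaGradAccum v₀ g k ω))
          * ‖g (k + 1) ω‖ ^ 2 := by rw [e]
      _ ≤ D₁ * (noiseWeight f D₀ D₁ η v₀ x₁ g k ω * s) * ‖g (k + 1) ω‖ ^ 2 := by gcongr
      _ = _ := by ring
  refine le_of_mul_le_mul_left ?_ hs
  have h3 : A ≤ s * √A := by
    nth_rewrite 1 [← Real.mul_self_sqrt hA]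
    exact mul_le_mul_of_nonneg_right hAs (Real.sqrt_nonneg _)
  linarith

variable [MeasurableSpace Ω] {μ : Measure Ω} [IsProbabilityMeasure μ]

namespace IsAffineStochasticGradient

theorem measurable_minGradSq (hL : 0 ≤ L) (hf : IsLSmooth f L)
    (h : IsAffineStochasticGradient μ f D₀ D₁ η v₀ x₁ g) (K : ℕ) (hK : 1 ≤ K) :
    Measurable (adaGradMinGradSq f η v₀ x₁ g K hK) := by
  have e : adaGradMinGradSq f η v₀ x₁ g K hK = (Finset.Icc 1 K).inf' (Finset.nonempty_Icc.mpr hK)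
      fun k ω => ‖gradient f (adaGradIter η v₀ x₁ g k ω)‖ ^ 2 := by
    ext ω
    rw [Finset.inf'_apply]
    rfl
  rw [e]
  refine Finset.inf'_induction (p := fun u : Ω → ℝ => Measurable u) _ _
    (fun _ h₁ _ h₂ => h₁.inf h₂) fun k hk => ?_
  obtain ⟨j, rfl⟩ := Nat.exists_eq_add_of_le' (Finset.mem_Icc.1 hk).1
  exact (h.measurable_gradient hL hf j).norm.pow_const 2

theorem integrable_minGradSq (hL : 0 ≤ L) (hf : IsLSmooth f L)
    (h : IsAffineStochasticGradient μ f D₀ D₁ η v₀ x₁ g) (K : ℕ) (hK : 1 ≤ K) :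
    Integrable (fun ω => adaGradMinGradSq f η v₀ x₁ g K hK ω) μ := by
  refine Integrable.of_bound (h.measurable_minGradSq hL hf K hK).aestronglyMeasurable
    (‖gradient f x₁‖ ^ 2) (ae_of_all _ fun ω => ?_)
  rw [Real.norm_of_nonneg (adaGradMinGradSq_nonneg hK ω)]
  exact adaGradMinGradSq_le_initial hK ω

theorem integrable_sqrt_minGradSq (hL : 0 ≤ L) (hf : IsLSmooth f L)
    (h : IsAffineStochasticGradient μ f D₀ D₁ η v₀ x₁ g) (K : ℕ) (hK : 1 ≤ K) :
    Integrable (fun ω => √(adaGradMinGradSq f η v₀ x₁ g K hK ω)) μ := by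
  refine Integrable.of_bound (h.measurable_minGradSq hL hf K hK).sqrt.aestronglyMeasurable
    ‖gradient f x₁‖ (ae_of_all _ fun ω => ?_)
  rw [Real.norm_of_nonneg (Real.sqrt_nonneg _)]
  exact Real.sqrt_le_iff.2 ⟨norm_nonneg _, adaGradMinGradSq_le_initial hK ω⟩

theorem integral_sqrt_minGradSq_le (hL : 0 ≤ L) (hf : IsLSmooth f L)
    (h : IsAffineStochasticGradient μ f D₀ D₁ η v₀ x₁ g) (K : ℕ) (hK : 1 ≤ K) :
    ∫ ω, √(adaGradMinGradSq f η v₀ x₁ g K hK ω) ∂μ ≤ ‖gradient f x₁‖ := by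
  have := integral_mono (h.integrable_sqrt_minGradSq hL hf K hK)
    (integrable_const ‖gradient f x₁‖) fun ω =>
    Real.sqrt_le_iff.2 ⟨norm_nonneg _, adaGradMinGradSq_le_initial hK ω⟩
  simpa using this

theorem mul_sq_integral_sqrt_minGradSq_le (hL : 0 ≤ L) (hη : 0 < η) (hv₀ : 0 < v₀)
    (hf : IsLSmooth f L) (h : IsAffineStochasticGradient μ f D₀ D₁ η v₀ x₁ g) (K : ℕ)
    (hK : 1 ≤ K) :
    K * (∫ ω, √(adaGradMinGradSq f η v₀ x₁ g K hK ω) ∂μ) ^ 2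
      ≤ (∫ ω, √(adaGradAccum v₀ g K ω) ∂μ)
        * ∫ ω, ∑ k ∈ Finset.range K, scaledGradSq f η v₀ x₁ g k ω ∂μ := by
  have := sq_integral_le_of_sq_le_mul (Z := fun ω => √K * √(adaGradMinGradSq f η v₀ x₁ g K hK ω))
    (h.integrable_sqrt_accum hv₀ K)
    (integrable_finsetSum (Finset.range K) fun k _ => h.integrable_scaledGradSq hL hη hv₀ hf k)
    ((h.integrable_sqrt_minGradSq hL hf K hK).const_mul _) (fun ω => Real.sqrt_nonneg _)
    (fun ω => Finset.sum_nonneg fun k _ => by positivity) (fun ω => by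
      rw [mul_pow, Real.sq_sqrt (Nat.cast_nonneg K), Real.sq_sqrt (adaGradMinGradSq_nonneg hK ω)]
      exact mul_adaGradMinGradSq_le hv₀ hK ω)
  rwa [integral_const_mul, mul_pow, Real.sq_sqrt (Nat.cast_nonneg K)] at this

theorem integral_sqrt_accum_le (hL : 0 ≤ L) (hη : 0 < η) (hv₀ : 0 < v₀) (hD₀ : 0 < D₀)
    (hD₁ : 0 < D₁) (hf : IsLSmooth f L) (h : IsAffineStochasticGradient μ f D₀ D₁ η v₀ x₁ g)
    (K : ℕ) :
    ∫ ω, √(adaGradAccum v₀ g K ω) ∂μ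
      ≤ √(v₀ + K * D₀) + D₁ * ∫ ω, ∑ k ∈ Finset.range K, scaledGradSq f η v₀ x₁ g k ω ∂μ := by
  have hA0 : ∀ ω, 0 ≤ v₀ + ∑ k ∈ Finset.range K,
      D₀ / (D₀ + D₁ * ‖runGradient f η v₀ x₁ g k ω‖ ^ 2) * ‖g (k + 1) ω‖ ^ 2 := fun ω =>
    add_nonneg hv₀.le (Finset.sum_nonneg fun k _ => by positivity)
  have hAs : Integrable (fun ω => ∑ k ∈ Finset.range K,
      D₀ / (D₀ + D₁ * ‖runGradient f η v₀ x₁ g k ω‖ ^ 2) * ‖g (k + 1) ω‖ ^ 2) μ :=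
    integrable_finsetSum _ fun k _ => h.integrable_bounded_noise hL hD₀ hD₁ hf k
  have hA := (integrable_const (μ := μ) v₀).add hAs
  have hW := integrable_finsetSum (Finset.range K) fun k _ =>
    h.integrable_noiseWeight_mul hL hv₀ hD₀ hD₁ hf k
  have hsA : Integrable (fun ω => √(v₀ + ∑ k ∈ Finset.range K,
      D₀ / (D₀ + D₁ * ‖runGradient f η v₀ x₁ g k ω‖ ^ 2) * ‖g (k + 1) ω‖ ^ 2)) μ := by
    refine Integrable.mono' ((integrable_const (1 : ℝ)).add hA)
      (Real.continuous_sqrt.comp_aestronglyMeasurable hA.aestronglyMeasurable)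
      (ae_of_all _ fun ω => ?_)
    rw [Real.norm_of_nonneg (Real.sqrt_nonneg _)]
    have := hA0 ω
    refine Real.sqrt_le_iff.2 ⟨add_nonneg zero_le_one this, ?_⟩
    change _ ≤ (1 + (v₀ + ∑ k ∈ Finset.range K,
      D₀ / (D₀ + D₁ * ‖runGradient f η v₀ x₁ g k ω‖ ^ 2) * ‖g (k + 1) ω‖ ^ 2)) ^ 2
    nlinarith
  have h1 := integral_mono (h.integrable_sqrt_accum hv₀ K) (hsA.add (hW.const_mul D₁))
    fun ω => sqrt_adaGradAccum_le (f := f) (η := η) (x₁ := x₁) hv₀ hD₀ hD₁ K ω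
  rw [integral_add' hsA (hW.const_mul D₁), integral_const_mul] at h1
  -- Jensen for the square root, as Cauchy-Schwarz against the constant 1.
  have h2 := sq_integral_le_of_sq_le_mul (integrable_const (μ := μ) (1 : ℝ)) hA hsA
    (fun _ => zero_le_one) hA0 (fun ω => by rw [Real.sq_sqrt (hA0 ω), one_mul]; rfl)
  have h3 : ∫ ω, (v₀ + ∑ k ∈ Finset.range K,
      D₀ / (D₀ + D₁ * ‖runGradient f η v₀ x₁ g k ω‖ ^ 2) * ‖g (k + 1) ω‖ ^ 2) ∂μ
      ≤ v₀ + K * D₀ := by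
    rw [integral_add (integrable_const _) hAs, integral_const, probReal_univ, one_smul,
      integral_finsetSum _ fun k _ => h.integrable_bounded_noise hL hD₀ hD₁ hf k]
    have := Finset.sum_le_sum fun k (_ : k ∈ Finset.range K) =>
      h.integral_bounded_noise_le hL hD₀ hD₁ hf k
    rw [Finset.sum_const, Finset.card_range, nsmul_eq_mul] at this
    gcongr
  rw [integral_const, probReal_univ, one_smul, one_mul] at h2
  have h4 := Real.le_sqrt_of_sq_le (h2.trans h3)
  have h5 : ∫ ω, ∑ k ∈ Finset.range K, noiseWeight f D₀ D₁ η v₀ x₁ g k ω * ‖g (k + 1) ω‖ ^ 2 ∂μ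
      ≤ ∫ ω, ∑ k ∈ Finset.range K, scaledGradSq f η v₀ x₁ g k ω ∂μ := by
    rw [integral_finsetSum _ fun k _ => h.integrable_noiseWeight_mul hL hv₀ hD₀ hD₁ hf k,
      integral_finsetSum _ fun k _ => h.integrable_scaledGradSq hL hη hv₀ hf k]
    exact Finset.sum_le_sum fun k _ => h.integral_noiseWeight_mul_le hL hη hv₀ hD₀ hD₁ hf k
  have h6 := mul_le_mul_of_nonneg_left h5 hD₁.le
  linarith

end IsAffineStochasticGradient

end MinGradient

/-! ### The trade-off and the constant. -/

/-- The final trade-off: `m` is the expected smallest gradient norm, `S` the expected `√(v K)` and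
`Q` the expected sum of scaled squared gradients. -/
theorem sq_mul_le_of_tradeoff {m S Q G v D₀ D₁ : ℝ} {K : ℕ} (hK : 1 ≤ K) (hm : 0 ≤ m)
    (hmG : m ≤ G) (hS : 0 < S) (hQ : 0 ≤ Q) (hv : 0 < v) (hD₀ : 0 < D₀) (hD₁ : 0 < D₁)
    (hmS : K * m ^ 2 ≤ S * Q) (hSQ : S ≤ √(v + K * D₀) + D₁ * Q) :
    m ^ 2 * S ≤ (4 * (v + D₀) + 2 * D₁ * G ^ 2) * Q := by
  have hK' : (1 : ℝ) ≤ K := by exact_mod_cast hK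
  have hmG2 : m ^ 2 ≤ G ^ 2 := by gcongr
  rcases le_total (D₁ * Q) √(v + K * D₀) with hc | hc
  · have h1 : S ^ 2 ≤ 4 * (v + K * D₀) := by
      have h2 : S ^ 2 ≤ (2 * √(v + K * D₀)) ^ 2 := by gcongr; linarith
      rwa [mul_pow, Real.sq_sqrt (by positivity), show (2 : ℝ) ^ 2 = 4 by norm_num] at h2
    have h3 : K * (m ^ 2 * S) ≤ K * (4 * (v + D₀) * Q) := by
      calc K * (m ^ 2 * S) = (K * m ^ 2) * S := by ring
        _ ≤ (S * Q) * S := by gcongr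
        _ = S ^ 2 * Q := by ring
        _ ≤ (4 * (v + K * D₀)) * Q := by gcongr
        _ ≤ (4 * (K * v + K * D₀)) * Q := by gcongr; nlinarith
        _ = _ := by ring
    have h4 := le_of_mul_le_mul_left h3 (by linarith)
    have : 0 ≤ 2 * D₁ * G ^ 2 * Q := by positivity
    linarith
  · have h1 : m ^ 2 * S ≤ G ^ 2 * (2 * (D₁ * Q)) := by gcongr; linarith
    have : 0 ≤ 4 * (v + D₀) * Q := by positivity
    linarith

theorem corollary3p3 (D₀ D₁ v₀ Γ : ℝ) (hD₀ : 0 < D₀) (hD₁ : 0 < D₁) (hv₀ : 0 < v₀) :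
    ∃ C : ℝ, 0 < C ∧
      ∀ (d : ℕ) (f : EuclideanSpace ℝ (Fin d) → ℝ) (L η : ℝ) (x₁ : EuclideanSpace ℝ (Fin d))
        (Ω : Type*) [MeasurableSpace Ω] (μ : Measure Ω) [IsProbabilityMeasure μ]
        (g : ℕ → Ω → EuclideanSpace ℝ (Fin d)),
        0 ≤ L → 0 < η → IsLSmooth f L → BddBelow (Set.range f) → ‖gradient f x₁‖ ≤ Γ →
        IsAffineStochasticGradient μ f D₀ D₁ η v₀ x₁ g →
        ∀ (K : ℕ) (hK : 1 ≤ K),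
          Integrable (fun ω => adaGradMinGradSq f η v₀ x₁ g K hK ω) μ ∧
          Integrable (fun ω => √(adaGradMinGradSq f η v₀ x₁ g K hK ω)) μ ∧
          Integrable (fun ω => √(adaGradAccum v₀ g K ω)) μ ∧
          Integrable (fun ω => Real.log (adaGradAccum v₀ g K ω)) μ ∧
          (∫ ω, √(adaGradMinGradSq f η v₀ x₁ g K hK ω) ∂μ) ^ 2
            ≤ C / (∫ ω, √(adaGradAccum v₀ g K ω) ∂μ)
              * adaGradBracket f L D₀ D₁ η v₀ x₁
                  ((∫ ω, Real.log (adaGradAccum v₀ g K ω) ∂μ) - Real.log v₀) ∧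
          (1 ≤ v₀ →
            (∫ ω, √(adaGradMinGradSq f η v₀ x₁ g K hK ω) ∂μ) ^ 2
              ≤ C / (∫ ω, √(adaGradAccum v₀ g K ω) ∂μ)
                * adaGradBracket f L D₀ D₁ η v₀ x₁
                    (∫ ω, Real.log (adaGradAccum v₀ g K ω) ∂μ)) := by
  -- The sum of the constants of the two cases of the trade-off.
  refine ⟨4 * (v₀ + D₀) + 2 * D₁ * Γ ^ 2, by positivity, ?_⟩
  intro d f L η x₁ Ω _ μ _ g hL hη hf hb hΓ h K hK
  have hS := h.integrable_sqrt_accum hv₀ K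
  have hS0 : 0 < ∫ ω, √(adaGradAccum v₀ g K ω) ∂μ := by
    have := integral_mono (integrable_const √v₀) hS fun ω => sqrt_le_sqrt_adaGradAccum K ω
    rw [integral_const, probReal_univ, one_smul] at this
    exact (Real.sqrt_pos.2 hv₀).trans_le this
  have hQ := h.integral_sum_scaledGradSq_le hL hη hv₀ hD₀ hD₁ hf hb K
  have key := sq_mul_le_of_tradeoff hK (integral_nonneg fun ω => Real.sqrt_nonneg _)
    ((h.integral_sqrt_minGradSq_le hL hf K hK).trans hΓ) hS0
    (integral_nonneg fun ω => Finset.sum_nonneg fun k _ => by positivity) hv₀ hD₀ hD₁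
    (h.mul_sq_integral_sqrt_minGradSq_le hL hη hv₀ hf K hK)
    (h.integral_sqrt_accum_le hL hη hv₀ hD₀ hD₁ hf K)
  have main : ∀ b, adaGradBracket f L D₀ D₁ η v₀ x₁
      ((∫ ω, Real.log (adaGradAccum v₀ g K ω) ∂μ) - Real.log v₀) ≤ b →
      (∫ ω, √(adaGradMinGradSq f η v₀ x₁ g K hK ω) ∂μ) ^ 2
        ≤ (4 * (v₀ + D₀) + 2 * D₁ * Γ ^ 2) / (∫ ω, √(adaGradAccum v₀ g K ω) ∂μ) * b := by
    intro b hb'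
    rw [div_mul_eq_mul_div, le_div_iff₀ hS0]
    exact key.trans (mul_le_mul_of_nonneg_left (hQ.trans hb') (by positivity))
  refine ⟨h.integrable_minGradSq hL hf K hK, h.integrable_sqrt_minGradSq hL hf K hK, hS,
    h.integrable_log_accum hv₀ K, main _ le_rfl, fun hv₁ => main _ ?_⟩
  -- The bracket is nondecreasing in its last argument, and `v₀ ≥ 1` makes the subtracted logarithm
  -- nonnegative.
  rw [adaGradBracket, adaGradBracket]
  have := Real.log_nonneg hv₁
  gcongr
  linarith
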